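/- For real $a_1,\dots,a_4$ and real $b_1,b_2,b_3$ none of which is a non-positive integer, let $${}_4F_3(a_1,a_2,a_3,a_4;b_1,b_2,b_3;z)=\sum_{k=0}^{\infty}\frac{(a_1)_k(a_2)_k(a_3)_k(a_4)_k}{(b_1)_k(b_2)_k(b_3)_k}\,\frac{z^k}{k!}$$ at real $z$ for which the series converges, where $(a)_0=1$ and $(a)_k=a(a+1)\cdots(a+k-1)$. Let $B(x,y)=\frac{\Gamma(x)\Gamma(y)}{\Gamma(x+y)}$ for $x,y>0$. Then the series defining ${}_4F_3\left(\tfrac14,\tfrac14,\tfrac12,\tfrac12;\tfrac54,\tfrac54,1;1\right)$ and the double series below converge absolutely, and $${}_4F_3\left(\tfrac14,\tfrac14,\tfrac12,\tfrac12;\tfrac54,\tfrac54,1;1\right)\cdot\frac{1}{B(\frac14,\frac12)^2}=\frac{8}{\pi^4}\sum_{n=1}^{\infty}\sum_{m=1}^{\infty}\frac{(-1)^{m+n}}{(2m-1)(2n-1)\left((2m-1)^2+(2n-1)^2\right)}.$$ -/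

import Mathlib

/-- The `n`-th term of the generalized hypergeometric series with upper parameters `a`, lower
parameters `b` and argument `z`; `(ascPochhammer ℝ n).eval x` is the rising factorial
`x (x + 1) ⋯ (x + n - 1)`. As usual, no lower parameter should be a non-positive integer. -/
noncomputable def hypergeometricTerm (a b : List ℝ) (z : ℝ) (n : ℕ) : ℝ :=
  (a.map fun x => (ascPochhammer ℝ n).eval x).prod /
    (b.map fun x => (ascPochhammer ℝ n).eval x).prod * (z ^ n / (n.factorial : ℝ))

/-- The generalized hypergeometric function `ₚF_q(a; b; z)`, where `p` and `q` are the lengths of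
the lists `a` and `b`. -/
noncomputable def generalizedHypergeometric (a b : List ℝ) (z : ℝ) : ℝ :=
  ∑' n : ℕ, hypergeometricTerm a b z n

/-- The term, for `n, m ≥ 1`, of the double series. -/
noncomputable def squareTerm (n m : ℕ+) : ℝ :=
  (-1 : ℝ) ^ ((m : ℕ) + (n : ℕ)) /
    ((2 * (m : ℝ) - 1) * (2 * (n : ℝ) - 1) * ((2 * (m : ℝ) - 1) ^ 2 + (2 * (n : ℝ) - 1) ^ 2))

/-! ### Taylor coefficients of $(1-x)^{-1/2}$ and of the square map -/

section

open scoped Nat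

/-! Both sides compute a mean of a quadratic function over the boundary of a square, for harmonic
measure at its centre. Write $f(z)=\int_0^z(1-t^4)^{-1/2}dt=\sum c_kz^{4k+1}$, the
Schwarz–Christoffel map of the disc to a square. The hypergeometric terms are $c_k^2$, so their sum
$S$ is the mean of $|f|^2$ over the unit circle (Parseval, `circleAverage_norm_squareMap_sq`), and
the half-diagonal is $L=f(1)=B(\frac14,\frac12)/4$.

Rotate $f$ to $g$, with image sides $|\mathrm{Re}\,w|=h$, $|\mathrm{Im}\,w|=h$, $h^2=L^2/2$. As
$g^2$ is holomorphic and vanishes at 0, the mean of $(\mathrm{Re}\,g)^2$ is $S/2$. For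
$x=\pi\,\mathrm{Re}\,w/(2h)$, expand $\frac{\pi}{8}(\frac{\pi^2}{4}-x^2)$ in the functions
$\cos((2n+1)x)$. On the boundary each equals the harmonic function $\mathrm{Re}\cos((2n+1)\pi
w/(2h))/\cosh((2n+1)\pi/2)$, whose mean is its value $1/\cosh((2n+1)\pi/2)$ at the centre. This
evaluates $\sum(-1)^n(2n+1)^{-3}/\cosh((2n+1)\pi/2)$ in terms of $S/L^2$
(`hasSum_neg_one_pow_div_cube_div_cosh`).

Summing the double series over $m$ by the partial fractions of the hyperbolic secant
(`tsum_sechTerm`) produces the same series. -/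

/-- The coefficients `(1/2)_k / k!` of the Taylor series of `(1 - x) ^ (-1/2)`. -/
noncomputable def invSqrtCoeff (k : ℕ) : ℝ := (ascPochhammer ℝ k).eval (1 / 2) / k !

lemma invSqrtCoeff_zero : invSqrtCoeff 0 = 1 := by simp [invSqrtCoeff]

lemma invSqrtCoeff_succ (k : ℕ) :
    invSqrtCoeff (k + 1) = invSqrtCoeff k * ((2 * k + 1) / (2 * k + 2)) := by
  have : (k ! : ℝ) ≠ 0 := by positivity
  have : (k : ℝ) + 1 ≠ 0 := by positivity
  have : 2 * (k : ℝ) + 2 ≠ 0 := by positivity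
  rw [invSqrtCoeff, invSqrtCoeff, ascPochhammer_succ_eval, Nat.factorial_succ]
  push_cast
  field_simp
  ring

lemma invSqrtCoeff_pos (k : ℕ) : 0 < invSqrtCoeff k := by
  induction k with
  | zero => simp [invSqrtCoeff_zero]
  | succ k ih => rw [invSqrtCoeff_succ]; positivity

/-- The induction step is $(2k+1)(2k+3)\le(2k+2)^2$. The resulting $O(k^{-3/2})$ bound on
`squareMapCoeff` makes the power series converge absolutely up to the unit circle. -/
lemma invSqrtCoeff_sq_le (k : ℕ) : invSqrtCoeff k ^ 2 ≤ 1 / (2 * k + 1) := by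
  induction k with
  | zero => simp [invSqrtCoeff_zero]
  | succ k ih =>
    rw [invSqrtCoeff_succ, mul_pow]
    refine (mul_le_mul_of_nonneg_right ih (by positivity)).trans ?_
    rw [div_pow, div_mul_div_comm, div_le_div_iff₀ (by positivity) (by positivity)]
    push_cast
    have : (0 : ℝ) ≤ k := by positivity
    nlinarith [mul_nonneg this this]

/-- The Taylor coefficients of `∫₀ᶻ (1 - t⁴) ^ (-1/2) dt`. -/
noncomputable def squareMapCoeff (k : ℕ) : ℝ := invSqrtCoeff k / (4 * k + 1)

lemma squareMapCoeff_pos (k : ℕ) : 0 < squareMapCoeff k :=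
  div_pos (invSqrtCoeff_pos k) (by positivity)

lemma squareMapCoeff_le (k : ℕ) : squareMapCoeff k ≤ 1 / ((k : ℝ) + 1) ^ (3 / 2 : ℝ) := by
  have hk : (0 : ℝ) < k + 1 := by positivity
  have h1 : invSqrtCoeff k ≤ 1 / ((k : ℝ) + 1) ^ (1 / 2 : ℝ) := by
    rw [← Real.sqrt_eq_rpow, one_div, ← Real.sqrt_inv, ← one_div]
    refine Real.le_sqrt_of_sq_le ((invSqrtCoeff_sq_le k).trans ?_)
    apply one_div_le_one_div_of_le hk
    linarith [(Nat.cast_nonneg k : (0 : ℝ) ≤ k)]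
  have h2 : ((k : ℝ) + 1) ^ (3 / 2 : ℝ) = ((k : ℝ) + 1) ^ (1 / 2 : ℝ) * (k + 1) := by
    rw [show (3 / 2 : ℝ) = 1 / 2 + 1 by norm_num, Real.rpow_add hk, Real.rpow_one]
  rw [h2, squareMapCoeff, ← div_div]
  have : (k : ℝ) + 1 ≤ 4 * k + 1 := by linarith [(Nat.cast_nonneg k : (0 : ℝ) ≤ k)]
  gcongr

lemma summable_squareMapCoeff : Summable squareMapCoeff := by
  refine Summable.of_nonneg_of_le (fun k => (squareMapCoeff_pos k).le) squareMapCoeff_le ?_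
  have := (summable_nat_add_iff 1).2
    (Real.summable_one_div_nat_rpow.2 (by norm_num : (1 : ℝ) < 3 / 2))
  simpa using this

lemma ascPochhammer_eval_five_quarters (k : ℕ) :
    (ascPochhammer ℝ k).eval (5 / 4) = (ascPochhammer ℝ k).eval (1 / 4) * (4 * k + 1) := by
  induction k with
  | zero => simp
  | succ k ih => rw [ascPochhammer_succ_eval, ascPochhammer_succ_eval, ih]; push_cast; ring

/-- Each quotient $(1/4)_k/(5/4)_k$ telescopes to $1/(4k+1)$, and $(1)_k\,k!=k!^2$. -/
lemma hypergeometricTerm_eq_squareMapCoeff_sq (k : ℕ) :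
    hypergeometricTerm [1 / 4, 1 / 4, 1 / 2, 1 / 2] [5 / 4, 5 / 4, 1] 1 k =
      squareMapCoeff k ^ 2 := by
  have h4 : (ascPochhammer ℝ k).eval (1 / 4) ≠ 0 := (ascPochhammer_pos k _ (by norm_num)).ne'
  have hk : (4 * (k : ℝ) + 1) ≠ 0 := by positivity
  have : (k ! : ℝ) ≠ 0 := by positivity
  simp only [hypergeometricTerm, List.map_cons, List.map_nil, List.prod_cons, List.prod_nil,
    ascPochhammer_eval_five_quarters, ascPochhammer_eval_one, one_pow, mul_one, squareMapCoeff,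
    invSqrtCoeff]
  field_simp

lemma summable_squareMapCoeff_sq : Summable fun k => squareMapCoeff k ^ 2 := by
  simpa only [sq] using! (summable_squareMapCoeff.mul_of_nonneg summable_squareMapCoeff
      (fun k => (squareMapCoeff_pos k).le) (fun k => (squareMapCoeff_pos k).le)).comp_injective
      (i := fun k : ℕ => (k, k)) (fun a b h => congrArg Prod.fst h)

lemma ring_choose_eq_invSqrtCoeff (n : ℕ) :
    Ring.choose (1 / 2 + n - 1 : ℂ) n = invSqrtCoeff n := by
  rw [Ring.choose_eq_smul, Polynomial.descPochhammer_smeval_eq_ascPochhammer,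
    show (1 / 2 + n - 1 : ℂ) - n + 1 = ((1 / 2 : ℝ) : ℂ) by push_cast; ring,
    Polynomial.ascPochhammer_smeval_eq_eval, invSqrtCoeff]
  have : (ascPochhammer ℂ n).eval ((1 / 2 : ℝ) : ℂ) =
      (((ascPochhammer ℝ n).eval (1 / 2) : ℝ) : ℂ) := by
    rw [← ascPochhammer_map Complex.ofRealHom, ← Complex.ofRealHom_eq_coe,
      Polynomial.eval_map_apply]
    rfl
  rw [this]
  push_cast
  simp [div_eq_inv_mul]

lemma hasSum_invSqrtCoeff {z : ℂ} (hz : ‖z‖ < 1) :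
    HasSum (fun k => (invSqrtCoeff k : ℂ) * z ^ k) (1 / (1 - z) ^ (1 / 2 : ℂ)) := by
  have := (Complex.one_div_one_sub_cpow_hasFPowerSeriesOnBall_zero (1 / 2)).hasSum (y := z)
    (by simpa [enorm_eq_nnnorm] using! hz)
  simpa only [FormalMultilinearSeries.ofScalars_apply_eq, ring_choose_eq_invSqrtCoeff,
    smul_eq_mul, zero_add] using this

end

/-! ### The square map on the closed disc and its value at 1 -/

section

open scoped Nat
open Complex Metric Set

/-- The map `z ↦ ∫₀ᶻ (1 - t⁴) ^ (-1/2) dt` of the closed unit disc onto a square. -/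
noncomputable def squareMap (z : ℂ) : ℂ := ∑' k, (squareMapCoeff k : ℂ) * z ^ (4 * k + 1)

lemma norm_squareMap_term_le {z : ℂ} (hz : ‖z‖ ≤ 1) (k : ℕ) :
    ‖(squareMapCoeff k : ℂ) * z ^ (4 * k + 1)‖ ≤ squareMapCoeff k := by
  rw [norm_mul, norm_pow, norm_real, Real.norm_of_nonneg (squareMapCoeff_pos k).le]
  exact mul_le_of_le_one_right (squareMapCoeff_pos k).le (pow_le_one₀ (norm_nonneg _) hz)

lemma hasSum_squareMap {z : ℂ} (hz : ‖z‖ ≤ 1) :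
    HasSum (fun k => (squareMapCoeff k : ℂ) * z ^ (4 * k + 1)) (squareMap z) :=
  (Summable.of_norm_bounded summable_squareMapCoeff (norm_squareMap_term_le hz)).hasSum

lemma continuousOn_squareMap : ContinuousOn squareMap (closedBall 0 1) :=
  continuousOn_tsum (fun k => by fun_prop) summable_squareMapCoeff
    fun k z hz => norm_squareMap_term_le (by simpa using hz) k

lemma squareMap_zero : squareMap 0 = 0 := by simp [squareMap]

lemma squareMap_I_mul (z : ℂ) : squareMap (I * z) = I * squareMap z := by
  rw [squareMap, squareMap, ← tsum_mul_left]
  congr 1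
  ext k
  rw [mul_pow, pow_succ I, pow_mul, I_pow_four, one_pow]
  ring

lemma hasDerivAt_squareMap {z : ℂ} (hz : ‖z‖ < 1) :
    HasDerivAt squareMap (1 / (1 - z ^ 4) ^ (1 / 2 : ℂ)) z := by
  -- Termwise differentiation needs a uniform majorant, available on a smaller disc of radius $r<1$.
  obtain ⟨r, hzr, hr1⟩ := exists_between hz
  have hr0 : 0 ≤ r := (norm_nonneg z).trans hzr.le
  have hu : Summable fun k => invSqrtCoeff k * (r ^ 4) ^ k := by
    have hr4 : ‖((r ^ 4 : ℝ) : ℂ)‖ < 1 := by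
      rw [norm_real, Real.norm_of_nonneg (by positivity)]
      exact pow_lt_one₀ hr0 hr1 (by norm_num)
    have := (hasSum_invSqrtCoeff hr4).summable
    exact_mod_cast this
  have key := hasDerivAt_tsum_of_isPreconnected
    (g := fun k w => (squareMapCoeff k : ℂ) * w ^ (4 * k + 1))
    (g' := fun k w => (invSqrtCoeff k : ℂ) * (w ^ 4) ^ k) (t := ball 0 r) (y₀ := z) (y := z)
    hu isOpen_ball (convex_ball _ _).isPreconnected ?_ ?_ (by simpa using hzr)
    (hasSum_squareMap hz.le).summable (by simpa using hzr)
  · rwa [(hasSum_invSqrtCoeff (z := z ^ 4) (by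
      rw [norm_pow]; exact pow_lt_one₀ (norm_nonneg _) hz (by norm_num))).tsum_eq] at key
  · intro k w _
    convert! (hasDerivAt_pow (4 * k + 1) w).const_mul (squareMapCoeff k : ℂ) using 1
    have : (4 * (k : ℂ) + 1) ≠ 0 := by exact_mod_cast (by positivity : (4 * (k : ℝ) + 1) ≠ 0)
    rw [squareMapCoeff, ← pow_mul]
    push_cast
    field_simp
  · intro k w hw
    rw [norm_mul, norm_pow, norm_pow, norm_real, Real.norm_of_nonneg (invSqrtCoeff_pos k).le]
    have := invSqrtCoeff_pos k
    have : ‖w‖ ≤ r := by simpa using (mem_ball_zero_iff.1 hw).le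
    gcongr

lemma diffContOnCl_squareMap : DiffContOnCl ℂ squareMap (ball 0 1) where
  differentiableOn z hz :=
    (hasDerivAt_squareMap (by simpa using hz)).differentiableAt.differentiableWithinAt
  continuousOn := by
    rw [closure_ball _ one_ne_zero]
    exact continuousOn_squareMap

/-- The half-diagonal of the square. -/
noncomputable def halfDiagonal : ℝ := ∑' k, squareMapCoeff k

lemma squareMap_one : squareMap 1 = halfDiagonal := by
  simp [squareMap, halfDiagonal, ofReal_tsum]

/-- The substitution $t=u^{1/4}$ turns the integral for $f(1)$ into a quarter of the beta integral.
-/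
lemma hasDerivAt_squareMap_rpow {x : ℝ} (hx : x ∈ Ioo (0 : ℝ) 1) :
    HasDerivAt (fun u : ℝ => (squareMap ((u ^ (1 / 4 : ℝ) : ℝ) : ℂ)).re)
      (x ^ (1 / 4 - 1 : ℝ) * (1 - x) ^ (1 / 2 - 1 : ℝ) / 4) x := by
  have hx4 : (x ^ (1 / 4 : ℝ)) ^ 4 = x := by
    rw [← Real.rpow_natCast, ← Real.rpow_mul hx.1.le]; norm_num
  have hlt : ‖((x ^ (1 / 4 : ℝ) : ℝ) : ℂ)‖ < 1 := by
    rw [norm_real, Real.norm_of_nonneg (Real.rpow_nonneg hx.1.le _)]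
    exact Real.rpow_lt_one hx.1.le hx.2 (by norm_num)
  have h1 := (hasDerivAt_squareMap hlt).real_of_complex
  have h2 := h1.comp x (Real.hasDerivAt_rpow_const (p := 1 / 4) (Or.inl hx.1.ne'))
  refine h2.congr_deriv ?_
  have : (1 / (1 - ((x ^ (1 / 4 : ℝ) : ℝ) : ℂ) ^ 4) ^ (1 / 2 : ℂ)).re =
      (1 - x) ^ (1 / 2 - 1 : ℝ) := by
    rw [← ofReal_pow, hx4, show (1 / 2 : ℂ) = ((1 / 2 : ℝ) : ℂ) by push_cast; rfl, ← ofReal_one,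
      ← ofReal_sub, ← ofReal_cpow (by linarith [hx.2]), ← ofReal_div, ofReal_re,
      show (1 / 2 - 1 : ℝ) = -(1 / 2) by norm_num, Real.rpow_neg (by linarith [hx.2]), one_div]
  rw [this]
  ring

lemma halfDiagonal_eq_beta : halfDiagonal = ProbabilityTheory.beta (1 / 4) (1 / 2) / 4 := by
  have hcont : ContinuousOn (fun u : ℝ => (squareMap ((u ^ (1 / 4 : ℝ) : ℝ) : ℂ)).re)
      (Icc 0 1) := by
    refine continuous_re.comp_continuousOn (continuousOn_squareMap.comp
      (continuous_ofReal.comp (Real.continuous_rpow_const (by norm_num))).continuousOn ?_)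
    intro x hx
    simp only [mem_closedBall, dist_zero_right, norm_real]
    rw [Real.norm_of_nonneg (Real.rpow_nonneg hx.1 _)]
    exact Real.rpow_le_one hx.1 hx.2 (by norm_num)
  have hpos : ∀ x ∈ Ioo (0 : ℝ) 1, 0 ≤ x ^ (1 / 4 - 1 : ℝ) * (1 - x) ^ (1 / 2 - 1 : ℝ) / 4 :=
    fun x hx => div_nonneg (mul_nonneg (Real.rpow_nonneg hx.1.le _)
      (Real.rpow_nonneg (by linarith [hx.2]) _)) (by norm_num)
  -- The integrand is singular at both ends; nonnegativity of the derivative of a continuous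
  -- function gives integrability.
  have hint := intervalIntegral.intervalIntegrable_deriv_of_nonneg (a := 0) (b := 1)
    (by rwa [uIcc_of_le zero_le_one])
    (by simpa only [min_eq_left zero_le_one, max_eq_right zero_le_one] using
      fun x hx => hasDerivAt_squareMap_rpow hx)
    (by simpa only [min_eq_left zero_le_one, max_eq_right zero_le_one] using hpos)
  have key := intervalIntegral.integral_eq_sub_of_hasDerivAt_of_le zero_le_one hcont
    (fun x hx => hasDerivAt_squareMap_rpow hx) hint
  rw [intervalIntegral.integral_div, Real.one_rpow, Real.zero_rpow (by norm_num), ofReal_one,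
    squareMap_one, ofReal_zero, squareMap_zero, ofReal_re, zero_re, sub_zero] at key
  rw [← key, ProbabilityTheory.beta_eq_betaIntegralReal _ _ (by norm_num) (by norm_num),
    betaIntegral]
  congr 1
  have : ∀ x ∈ uIcc (0 : ℝ) 1, (x : ℂ) ^ (((1 / 4 : ℝ) : ℂ) - 1) *
      (1 - (x : ℂ)) ^ (((1 / 2 : ℝ) : ℂ) - 1) =
      ((x ^ (1 / 4 - 1 : ℝ) * (1 - x) ^ (1 / 2 - 1 : ℝ) : ℝ) : ℂ) := by
    intro x hx
    rw [uIcc_of_le zero_le_one] at hx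
    rw [ofReal_mul, ofReal_cpow hx.1, ofReal_cpow (by linarith [hx.2])]
    push_cast
    rfl
  rw [intervalIntegral.integral_congr this, intervalIntegral.integral_ofReal, ofReal_re]

lemma halfDiagonal_pos : 0 < halfDiagonal := by
  rw [halfDiagonal_eq_beta]
  exact div_pos (ProbabilityTheory.beta_pos (by norm_num) (by norm_num)) (by norm_num)

end

/-! ### The unit circle is mapped into the boundary of a square -/

section

open Complex Metric Set Filter
open scoped Topology

/-- For $0<\theta<\pi/2$ this is a polar form with argument in $(-\pi/2,\pi/2)$, which fixes the
principal square root. -/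
lemma one_sub_exp_four_mul (θ : ℝ) :
    1 - exp (θ * I) ^ 4 =
      ((2 * Real.sin (2 * θ) : ℝ) : ℂ) * exp (((2 * θ - Real.pi / 2 : ℝ) : ℂ) * I) := by
  have h1 : exp (((2 * θ - Real.pi / 2 : ℝ) : ℂ) * I) = exp (θ * I) ^ 2 * (-I) := by
    rw [← exp_neg_pi_div_two_mul_I, ← exp_nat_mul, ← exp_add]
    congr 1
    push_cast
    ring
  have h2 : ((2 * Real.sin (2 * θ) : ℝ) : ℂ) =
      (((exp (θ * I)) ^ 2)⁻¹ - exp (θ * I) ^ 2) * I := by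
    rw [← exp_nat_mul, ← exp_neg]
    push_cast
    rw [Complex.sin]
    ring_nf
  rw [h1, h2]
  have := exp_ne_zero (θ * I)
  field_simp
  linear_combination (1 - exp (θ * I) ^ 4) * I_sq

lemma one_sub_exp_four_mul_mem_slitPlane {θ : ℝ} (hθ : θ ∈ Ioo 0 (Real.pi / 2)) :
    1 - exp (θ * I) ^ 4 ∈ slitPlane := by
  have hs : 0 < Real.sin (2 * θ) := Real.sin_pos_of_pos_of_lt_pi (by linarith [hθ.1])
    (by linarith [hθ.2])
  rw [one_sub_exp_four_mul, mem_slitPlane_iff, re_ofReal_mul, exp_ofReal_mul_I_re]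
  left
  refine mul_pos (by positivity) (Real.cos_pos_of_mem_Ioo ⟨?_, ?_⟩) <;>
    linarith [hθ.1, hθ.2]

/-- The derivative inside the disc extends continuously to this boundary point, so $f$ is
differentiable there relative to the closed disc, and the chain rule applies along the circle. -/
lemma hasDerivAt_squareMap_exp {θ : ℝ} (hθ : θ ∈ Ioo 0 (Real.pi / 2)) :
    HasDerivAt (fun t : ℝ => squareMap (exp (t * I)))
      (1 / (1 - exp (θ * I) ^ 4) ^ (1 / 2 : ℂ) * (exp (θ * I) * I)) θ := by
  have hslit := one_sub_exp_four_mul_mem_slitPlane hθ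
  have hd : ∀ z ∈ ball (0 : ℂ) 1, HasFDerivAt squareMap
      ((1 / (1 - z ^ 4) ^ (1 / 2 : ℂ)) • (1 : ℂ →L[ℝ] ℂ)) z := fun z hz =>
    (hasDerivAt_squareMap (by simpa using hz)).complexToReal_fderiv
  have hc : ContinuousAt (fun z : ℂ => 1 / (1 - z ^ 4) ^ (1 / 2 : ℂ)) (exp (θ * I)) := by
    refine ContinuousAt.div continuousAt_const
      (ContinuousAt.cpow (by fun_prop) continuousAt_const hslit) ?_
    rw [Ne, cpow_eq_zero_iff]
    exact fun h => slitPlane_ne_zero hslit h.1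
  have h : HasFDerivWithinAt squareMap
      ((1 / (1 - exp (θ * I) ^ 4) ^ (1 / 2 : ℂ)) • (1 : ℂ →L[ℝ] ℂ))
      (closure (ball 0 1)) (exp (θ * I)) := by
    refine hasFDerivWithinAt_closure_of_tendsto_fderiv
      (fun z hz => (hd z hz).differentiableAt.differentiableWithinAt) (convex_ball _ _) isOpen_ball
      (fun z hz => (diffContOnCl_squareMap.continuousOn z hz).mono subset_closure) ?_
    refine ((hc.tendsto.mono_left nhdsWithin_le_nhds).smul_const _).congr' ?_
    filter_upwards [self_mem_nhdsWithin] with z hz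
    exact (hd z hz).fderiv.symm
  have hexp : HasDerivAt (fun t : ℝ => exp (t * I)) (exp (θ * I) * I) θ := by
    simpa using ((hasDerivAt_id θ).ofReal_comp.mul_const I).cexp
  have := h.comp_hasDerivAt θ hexp (Eventually.of_forall fun t => by
    rw [closure_ball _ one_ne_zero]
    simp [norm_exp_ofReal_mul_I])
  simpa using! this

/-- `squareMap` rotated so that the sides of the square are parallel to the axes. -/
noncomputable def alignedSquareMap (z : ℂ) : ℂ := exp (-(Real.pi / 4 : ℝ) * I) * squareMap z

/-- The phases $-\pi/4$, $\theta+\pi/2$ and $-(\theta-\pi/4)$ add up to $\pi/2$: the image of the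
quarter circle moves straight upwards. -/
lemma hasDerivAt_alignedSquareMap_exp {θ : ℝ} (hθ : θ ∈ Ioo 0 (Real.pi / 2)) :
    HasDerivAt (fun t : ℝ => alignedSquareMap (exp (t * I)))
      (((Real.exp (-(Real.log (2 * Real.sin (2 * θ)) / 2)) : ℝ) : ℂ) * I) θ := by
  refine ((hasDerivAt_squareMap_exp hθ).const_mul (exp (-(Real.pi / 4 : ℝ) * I))).congr_deriv ?_
  have hs : 0 < Real.sin (2 * θ) := Real.sin_pos_of_pos_of_lt_pi (by linarith [hθ.1])
    (by linarith [hθ.2])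
  have hslit := one_sub_exp_four_mul_mem_slitPlane hθ
  have hpi := Real.pi_pos
  rw [cpow_def_of_ne_zero (slitPlane_ne_zero hslit), one_sub_exp_four_mul,
    log_ofReal_mul (by positivity) (exp_ne_zero _),
    log_exp (by simp; linarith [hθ.1]) (by simp; linarith [hθ.2]), one_div, ← exp_neg,
    ← mul_assoc, ← mul_assoc, ← exp_add, ← exp_add, ofReal_exp]
  congr 2
  push_cast
  ring

lemma continuous_alignedSquareMap_exp :
    Continuous fun t : ℝ => alignedSquareMap (exp (t * I)) := by
  refine continuous_const.mul (continuousOn_squareMap.comp_continuous (by fun_prop) fun t => ?_)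
  simp [norm_exp_ofReal_mul_I]

lemma alignedSquareMap_I_mul (z : ℂ) : alignedSquareMap (I * z) = I * alignedSquareMap z := by
  rw [alignedSquareMap, alignedSquareMap, squareMap_I_mul]
  ring

lemma alignedSquareMap_zero : alignedSquareMap 0 = 0 := by
  simp [alignedSquareMap, squareMap_zero]

/-- Half the length of a side of the square. -/
noncomputable def halfSide : ℝ := halfDiagonal * (√2 / 2)

lemma halfSide_pos : 0 < halfSide := mul_pos halfDiagonal_pos (by positivity)

lemma halfSide_sq : halfSide ^ 2 = halfDiagonal ^ 2 / 2 := by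
  rw [halfSide, mul_pow, div_pow, Real.sq_sqrt (by norm_num)]
  ring

lemma alignedSquareMap_one : alignedSquareMap 1 = halfSide - halfSide * I := by
  rw [alignedSquareMap, squareMap_one, ← ofReal_neg, exp_mul_I, ← ofReal_cos, ← ofReal_sin, Real.cos_neg,
    Real.sin_neg, Real.cos_pi_div_four, Real.sin_pi_div_four, halfSide]
  push_cast
  ring

lemma alignedSquareMap_exp_re {θ : ℝ} (hθ : θ ∈ Icc 0 (Real.pi / 2)) :
    (alignedSquareMap (exp (θ * I))).re = halfSide := by
  rcases hθ.1.eq_or_lt with rfl | h0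
  · simp [alignedSquareMap_one]
  obtain ⟨c, hc, h⟩ := exists_hasDerivAt_eq_slope
    (fun t : ℝ => (alignedSquareMap (exp (t * I))).re)
    (fun _ => 0) h0 (continuous_re.comp continuous_alignedSquareMap_exp).continuousOn
    (fun t ht => by
      simpa only [reCLM_apply, re_ofReal_mul, I_re, mul_zero] using!
        reCLM.hasFDerivAt.comp_hasDerivAt t
        (hasDerivAt_alignedSquareMap_exp ⟨ht.1, ht.2.trans_le hθ.2⟩))
  have h1 : (alignedSquareMap (exp ((0 : ℝ) * I))).re = halfSide := by
    simp [alignedSquareMap_one]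
  rw [eq_comm, div_eq_zero_iff, h1] at h
  rcases h with h | h <;> linarith

lemma monotoneOn_alignedSquareMap_exp_im :
    MonotoneOn (fun t : ℝ => (alignedSquareMap (exp (t * I))).im) (Icc 0 (Real.pi / 2)) := by
  have hd : ∀ t ∈ Ioo 0 (Real.pi / 2), HasDerivAt
      (fun t : ℝ => (alignedSquareMap (exp (t * I))).im)
      (Real.exp (-(Real.log (2 * Real.sin (2 * t)) / 2))) t := fun t ht => by
    simpa only [imCLM_apply, im_ofReal_mul, I_im, mul_one] using!
      imCLM.hasFDerivAt.comp_hasDerivAt t (hasDerivAt_alignedSquareMap_exp ht)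
  refine monotoneOn_of_deriv_nonneg (convex_Icc _ _)
    (continuous_im.comp continuous_alignedSquareMap_exp).continuousOn ?_ ?_
  · rw [interior_Icc]
    exact fun t ht => (hd t ht).differentiableAt.differentiableWithinAt
  · rw [interior_Icc]
    intro t ht
    rw [(hd t ht).deriv]
    positivity

lemma abs_alignedSquareMap_exp_im_le {θ : ℝ} (hθ : θ ∈ Icc 0 (Real.pi / 2)) :
    |(alignedSquareMap (exp (θ * I))).im| ≤ halfSide := by
  have hpi := Real.pi_pos
  have h0 := monotoneOn_alignedSquareMap_exp_im ⟨le_rfl, by linarith⟩ hθ hθ.1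
  have h1 := monotoneOn_alignedSquareMap_exp_im hθ ⟨by linarith, le_rfl⟩ hθ.2
  have e1 : exp (((Real.pi / 2 : ℝ) : ℂ) * I) = I * 1 := by
    push_cast
    rw [exp_pi_div_two_mul_I, mul_one]
  -- The quarter circle ends at $i$, where $g(i)=i\,g(1)$ is the upper corner.
  simp only [e1, alignedSquareMap_I_mul] at h1
  simp [alignedSquareMap_one] at h0 h1
  exact abs_le.2 ⟨h0, h1⟩

/-- The boundary of the square `|re w| ≤ a`, `|im w| ≤ a`. -/
def squareBoundary (a : ℝ) : Set ℂ :=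
  {w | |w.re| = a ∧ |w.im| ≤ a ∨ |w.im| = a ∧ |w.re| ≤ a}

lemma I_mul_mem_squareBoundary {a : ℝ} {w : ℂ} (h : w ∈ squareBoundary a) :
    I * w ∈ squareBoundary a := by
  simpa [squareBoundary, or_comm] using h

/-- The symmetry $g(iz)=i\,g(z)$ carries the first quarter circle to the others. -/
lemma alignedSquareMap_exp_mem_squareBoundary (n : ℕ) {θ : ℝ}
    (hθ : θ ∈ Icc (n * (Real.pi / 2)) ((n + 1) * (Real.pi / 2))) :
    alignedSquareMap (exp (θ * I)) ∈ squareBoundary halfSide := by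
  induction n generalizing θ with
  | zero =>
    have hθ' : θ ∈ Icc 0 (Real.pi / 2) := by simpa using hθ
    left
    rw [alignedSquareMap_exp_re hθ', abs_of_pos halfSide_pos]
    exact ⟨rfl, abs_alignedSquareMap_exp_im_le hθ'⟩
  | succ n ih =>
    push_cast at hθ
    have h := I_mul_mem_squareBoundary (ih (θ := θ - Real.pi / 2)
      ⟨by linarith [hθ.1], by linarith [hθ.2]⟩)
    rw [← alignedSquareMap_I_mul] at h
    rwa [show I * exp (((θ - Real.pi / 2 : ℝ) : ℂ) * I) = exp (θ * I) by
      rw [show (θ : ℂ) * I = Real.pi / 2 * I + ((θ - Real.pi / 2 : ℝ) : ℂ) * I by push_cast; ring,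
        exp_add, exp_pi_div_two_mul_I]] at h

lemma alignedSquareMap_mem_squareBoundary {z : ℂ} (hz : ‖z‖ = 1) :
    alignedSquareMap z ∈ squareBoundary halfSide := by
  have hpi : 0 < Real.pi / 2 := by linarith [Real.pi_pos]
  obtain ⟨t, rfl⟩ := (norm_eq_one_iff z).1 hz
  set s := toIcoMod Real.two_pi_pos 0 t
  have hs : s ∈ Ico 0 (2 * Real.pi) := by
    simpa using toIcoMod_mem_Ico Real.two_pi_pos 0 t
  have hts : exp (t * I) = exp (s * I) := by
    rw [exp_eq_exp_iff_exists_int]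
    refine ⟨toIcoDiv Real.two_pi_pos 0 t, ?_⟩
    have := toIcoMod_add_toIcoDiv_zsmul Real.two_pi_pos 0 t
    rw [zsmul_eq_mul] at this
    have h' : (s : ℂ) + toIcoDiv Real.two_pi_pos 0 t * (2 * Real.pi) = t := by
      exact_mod_cast this
    linear_combination -I * h'
  rw [hts]
  refine alignedSquareMap_exp_mem_squareBoundary ⌊s / (Real.pi / 2)⌋₊ ⟨?_, ?_⟩
  · exact (le_div_iff₀ hpi).1 (Nat.floor_le (div_nonneg hs.1 hpi.le))
  · exact (div_le_iff₀ hpi).1 (Nat.lt_floor_add_one _).le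

end

/-! ### Fourier cosine series of a quadratic polynomial -/

section

open Complex

open scoped Nat in
lemma hasSum_neg_one_pow_div_cube_mul_cos {x : ℝ} (hx : |x| ≤ Real.pi / 2) :
    HasSum (fun n : ℕ => (-1) ^ n / (2 * n + 1 : ℝ) ^ 3 * Real.cos ((2 * n + 1) * x))
      (Real.pi / 8 * (Real.pi ^ 2 / 4 - x ^ 2)) := by
  have hpi := Real.pi_pos
  obtain ⟨hx1, hx2⟩ := abs_le.1 hx
  -- The Fourier series of the Bernoulli polynomial $B_3$ is $\sum\sin(2\pi ny)/n^3$ up to a factor.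
  -- Half the difference of its values at $y$ and $y+\frac12$ keeps the odd $n$ only; the offset
  -- $\frac14$ turns sines into cosines with sign $(-1)^n$.
  set y := 1 / 4 + x / (2 * Real.pi) with hy
  have hxy : x = 2 * Real.pi * y - Real.pi / 2 := by rw [hy]; field_simp; ring
  have hy0 : 0 ≤ y := by
    by_contra! h
    nlinarith
  have hy1 : y ≤ 1 / 2 := by
    by_contra! h
    nlinarith
  have h1 := hasSum_one_div_nat_pow_mul_sin one_ne_zero (x := y) ⟨hy0, by linarith⟩
  have h2 := hasSum_one_div_nat_pow_mul_sin one_ne_zero (x := y + 1 / 2)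
    ⟨by linarith, by linarith⟩
  have h := (h1.sub h2).mul_left (1 / 2)
  have hB : (Polynomial.map (algebraMap ℚ ℝ) (Polynomial.bernoulli (2 * 1 + 1))) =
      Polynomial.X ^ 3 - Polynomial.C (3 / 2) * Polynomial.X ^ 2 +
        Polynomial.C (1 / 2) * Polynomial.X := by
    simp only [Polynomial.bernoulli, Finset.sum_range_succ, Finset.range_one,
      Finset.sum_singleton, bernoulli_eq_bernoulli'_of_ne_one (by decide : 3 ≠ 1),
      bernoulli'_three, bernoulli_one, bernoulli_zero, Polynomial.map_add,
      ← Polynomial.C_mul_X_pow_eq_monomial]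
    norm_num [Nat.choose, Polynomial.C_neg, neg_div]
    ring
  rw [hB] at h
  have hinj : Function.Injective fun n : ℕ => 2 * n + 1 := fun a b hab => by
    simp only at hab; omega
  rw [← hinj.hasSum_iff] at h
  · convert! h using 1
    · ext n
      have e1 : Real.sin (2 * Real.pi * ((2 * n + 1 : ℕ) : ℝ) * y) =
          (-1) ^ n * Real.cos ((2 * n + 1) * x) := by
        rw [show 2 * Real.pi * ((2 * n + 1 : ℕ) : ℝ) * y =
          (2 * n + 1) * x + Real.pi / 2 + n * Real.pi by rw [hxy]; push_cast; ring,
          Real.sin_add_nat_mul_pi, Real.sin_add_pi_div_two]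
      have e2 : Real.sin (2 * Real.pi * ((2 * n + 1 : ℕ) : ℝ) * (y + 1 / 2)) =
          -((-1) ^ n * Real.cos ((2 * n + 1) * x)) := by
        rw [← e1, show 2 * Real.pi * ((2 * n + 1 : ℕ) : ℝ) * (y + 1 / 2) =
          2 * Real.pi * ((2 * n + 1 : ℕ) : ℝ) * y + (2 * n + 1 : ℕ) * Real.pi by ring,
          Real.sin_add_nat_mul_pi, pow_succ, pow_mul]
        simp
      simp only [Function.comp, e1, e2]
      push_cast
      ring
    · simp only [Polynomial.eval_add, Polynomial.eval_sub, Polynomial.eval_mul,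
        Polynomial.eval_pow, Polynomial.eval_X, Polynomial.eval_C]
      rw [hxy]
      norm_num [Nat.factorial]
      ring
  · intro n hn
    obtain ⟨k, rfl⟩ : Even n := by
      by_contra hodd
      obtain ⟨k, rfl⟩ := Nat.not_even_iff_odd.1 hodd
      exact hn ⟨k, rfl⟩
    rw [show 2 * Real.pi * ((k + k : ℕ) : ℝ) * (y + 1 / 2) =
      2 * Real.pi * ((k + k : ℕ) : ℝ) * y + k * (2 * Real.pi) by push_cast; ring,
      Real.sin_add_nat_mul_two_pi]
    ring

/-! ### Partial fractions of the hyperbolic secant, from those of the cotangent -/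

lemma cot_add_cot (x : ℂ) (h1 : sin (Real.pi / 4 + x) ≠ 0) (h2 : sin (Real.pi / 4 - x) ≠ 0)
    (h3 : cos (2 * x) ≠ 0) :
    cot (Real.pi / 4 + x) + cot (Real.pi / 4 - x) = 2 / cos (2 * x) := by
  rw [cot_eq_cos_div_sin, cot_eq_cos_div_sin, div_add_div _ _ h1 h2,
    div_eq_div_iff (mul_ne_zero h1 h2) h3]
  have e1 : cos (Real.pi / 4 + x) * sin (Real.pi / 4 - x) +
      sin (Real.pi / 4 + x) * cos (Real.pi / 4 - x) = 1 := by
    rw [add_comm, ← sin_add, ← sin_pi_div_two]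
    congr 1
    ring
  have e2 : cos (2 * x) = 2 * (sin (Real.pi / 4 + x) * sin (Real.pi / 4 - x)) := by
    have hs : sin (Real.pi / 4 + x) = cos (Real.pi / 4 - x) := by
      rw [← cos_pi_div_two_sub]
      congr 1
      ring
    have := sin_two_mul (Real.pi / 4 - x)
    rw [show 2 * (Real.pi / 4 - x) = Real.pi / 2 - 2 * x by ring, sin_pi_div_two_sub] at this
    rw [this, hs]
    ring
  rw [add_comm] at e1
  rw [show cos (Real.pi / 4 + x) * sin (Real.pi / 4 - x) +
      sin (Real.pi / 4 + x) * cos (Real.pi / 4 - x) = 1 by linear_combination e1, e2]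
  ring

/-- The general term of the partial fraction expansion of the hyperbolic secant. -/
noncomputable def sechTerm (a : ℝ) (m : ℕ) : ℝ :=
  (-1) ^ m / ((2 * m + 1) * ((2 * m + 1) ^ 2 + a ^ 2))

lemma abs_sechTerm_le (a : ℝ) (m : ℕ) : |sechTerm a m| ≤ 1 / ((m : ℝ) + 1) ^ 2 := by
  have hm : (0 : ℝ) ≤ m := m.cast_nonneg
  rw [sechTerm, abs_div, abs_pow, abs_neg, abs_one, one_pow, abs_of_pos (by positivity)]
  apply one_div_le_one_div_of_le (by positivity)
  have : ((m : ℝ) + 1) ^ 2 ≤ 1 * ((2 * m + 1) ^ 2 + a ^ 2) := by nlinarith [sq_nonneg a]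
  exact this.trans (mul_le_mul_of_nonneg_right (by linarith) (by positivity))

lemma summable_sechTerm (a : ℝ) : Summable (sechTerm a) := by
  refine Summable.of_norm_bounded ?_ (abs_sechTerm_le a)
  exact_mod_cast (summable_nat_add_iff 1).2 (Real.summable_one_div_nat_pow.2 one_lt_two)

lemma mem_integerComplement_of_im_ne_zero_or_re_eq {z : ℂ} (hz : z.im ≠ 0 ∨ z.re = 1 / 4) :
    z ∈ integerComplement := by
  rintro ⟨n, rfl⟩
  rcases hz with h | h
  · simp at h
  · rw [intCast_re] at h
    have : (4 * n : ℤ) = 1 := by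
      have : (4 * n : ℝ) = 1 := by linarith
      exact_mod_cast this
    omega

/-- For $\beta=1,-3,5,-7,\dots$, that is $\beta=(-1)^m(2m+1)$, the right side is $-8a^2$ times
`sechTerm a m`. Subtracting $8/\beta$, the value at $a=0$, creates the extra factor $1/\beta$. -/
lemma one_div_add_one_div_sub_eq (a : ℝ) {β : ℝ} (hβ : β ≠ 0) :
    1 / ((β : ℂ) / 4 + a / 4 * I) + 1 / ((β : ℂ) / 4 - a / 4 * I) - 8 / β =
      ((-8 * a ^ 2 / (β * (β ^ 2 + a ^ 2)) : ℝ) : ℂ) := by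
  set t : ℂ := a / 4 * I with ht
  have ht2 : t ^ 2 = -(a : ℂ) ^ 2 / 16 := by rw [ht, mul_pow, I_sq]; ring
  have hβ' : (β : ℂ) ≠ 0 := by exact_mod_cast hβ
  have h1 : (β : ℂ) / 4 + t ≠ 0 := fun h => by
    have := congrArg re h
    simp [ht] at this
    exact hβ (by linarith)
  have h2 : (β : ℂ) / 4 - t ≠ 0 := fun h => by
    have := congrArg re h
    simp [ht] at this
    exact hβ (by linarith)
  have h3 : (β : ℂ) ^ 2 + (a : ℂ) ^ 2 ≠ 0 := by
    exact_mod_cast (by positivity : β ^ 2 + a ^ 2 ≠ 0)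
  have h4 : ((β : ℂ) / 4 + t) * ((β : ℂ) / 4 - t) = ((β : ℂ) ^ 2 + (a : ℂ) ^ 2) / 16 := by
    linear_combination -ht2
  rw [div_add_div _ _ h1 h2, h4]
  push_cast
  field_simp
  ring

lemma pi_mul_cot_add_pi_mul_cot {a : ℝ} (ha : a ≠ 0) :
    Real.pi * cot (Real.pi * (1 / 4 + a / 4 * I)) + Real.pi * cot (Real.pi * (1 / 4 - a / 4 * I)) =
      ((2 * Real.pi / Real.cosh (Real.pi * a / 2) : ℝ) : ℂ) := by
  set t : ℂ := a / 4 * I with ht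
  have hp : 1 / 4 + t ∈ integerComplement :=
    mem_integerComplement_of_im_ne_zero_or_re_eq (by left; simp [ht, ha])
  have hm : 1 / 4 - t ∈ integerComplement :=
    mem_integerComplement_of_im_ne_zero_or_re_eq (by left; simp [ht, ha])
  have hs1 := sin_pi_mul_ne_zero hp
  have hs2 := sin_pi_mul_ne_zero hm
  have e1 : Real.pi * (1 / 4 + t) = Real.pi / 4 + Real.pi * t := by ring
  have e2 : Real.pi * (1 / 4 - t) = Real.pi / 4 - Real.pi * t := by ring
  have hcos : cos (2 * (Real.pi * t)) = ((Real.cosh (Real.pi * a / 2) : ℝ) : ℂ) := by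
    rw [ht, show (2 : ℂ) * (Real.pi * (a / 4 * I)) = ((Real.pi * a / 2 : ℝ) : ℂ) * I by
      push_cast; ring, cos_mul_I, ofReal_cosh]
  rw [e1] at hs1 ⊢
  rw [e2] at hs2 ⊢
  rw [← mul_add, cot_add_cot _ hs1 hs2, hcos]
  · push_cast
    ring
  · rw [hcos]
    exact_mod_cast (Real.cosh_pos _).ne'

lemma cot_pi_mul_one_fourth : cot (Real.pi * (1 / 4)) = 1 := by
  have h0 : (1 / 4 : ℂ) ∈ integerComplement :=
    mem_integerComplement_of_im_ne_zero_or_re_eq (by right; norm_num)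
  have h := cot_add_cot 0 (by simpa [div_eq_mul_inv] using sin_pi_mul_ne_zero h0)
    (by simpa [div_eq_mul_inv] using sin_pi_mul_ne_zero h0) (by simp)
  simp only [add_zero, sub_zero, mul_zero, cos_zero] at h
  rw [mul_one_div]
  linear_combination h / 2

lemma sechTerm_two_mul_add_one (a : ℝ) (n : ℕ) :
    sechTerm a (2 * n + 1) = 1 / (-(4 * n + 3) * ((-(4 * n + 3)) ^ 2 + a ^ 2)) := by
  rw [sechTerm, pow_succ, pow_mul]
  push_cast
  rw [neg_one_sq, one_pow, one_mul, neg_mul, one_div, inv_neg, neg_div, one_div]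
  ring_nf

lemma sechTerm_two_mul_add_two (a : ℝ) (n : ℕ) :
    sechTerm a (2 * n + 1 + 1) = 1 / ((4 * n + 5) * ((4 * n + 5) ^ 2 + a ^ 2)) := by
  rw [sechTerm, pow_succ, pow_succ, pow_mul]
  push_cast
  rw [neg_one_sq, one_pow]
  ring_nf

/-- Add the expansions of $\pi\cot\pi z$ at $z=\frac14\pm\frac{ai}{4}$ and subtract twice the one at
$\frac14$. The poles $\pm(n+1)$ give $\beta=4n+5$ and $-(4n+3)$; the pole at 0 gives $\beta=1$,
moved to the right. -/
lemma hasSum_sechTerm_pairs {a : ℝ} (ha : a ≠ 0) :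
    HasSum (fun n => -8 * a ^ 2 * (sechTerm a (2 * n + 1) + sechTerm a (2 * n + 1 + 1)))
      (2 * Real.pi / Real.cosh (Real.pi * a / 2) - 2 * Real.pi + 8 * a ^ 2 / (1 + a ^ 2)) := by
  have hcot := pi_mul_cot_add_pi_mul_cot ha
  set t : ℂ := a / 4 * I with ht
  have hp : 1 / 4 + t ∈ integerComplement :=
    mem_integerComplement_of_im_ne_zero_or_re_eq (by left; simp [ht, ha])
  have hm : 1 / 4 - t ∈ integerComplement :=
    mem_integerComplement_of_im_ne_zero_or_re_eq (by left; simp [ht, ha])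
  have h0 : (1 / 4 : ℂ) ∈ integerComplement :=
    mem_integerComplement_of_im_ne_zero_or_re_eq (by right; norm_num)
  have S := ((summable_cotTerm hp).hasSum.add (summable_cotTerm hm).hasSum).sub
    ((summable_cotTerm h0).hasSum.mul_left 2)
  rw [← cot_series_rep' hp, ← cot_series_rep' hm, ← cot_series_rep' h0,
    cot_pi_mul_one_fourth] at S
  rw [← hasSum_ofReal]
  convert! S using 1
  · ext n
    have h1 := one_div_add_one_div_sub_eq a (β := -(4 * n + 3)) (neg_ne_zero.2 (by positivity))
    have h2 := one_div_add_one_div_sub_eq a (β := 4 * n + 5) (by positivity)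
    rw [← ht] at h1 h2
    rw [sechTerm_two_mul_add_one, sechTerm_two_mul_add_two, mul_add, mul_one_div, mul_one_div,
      ofReal_add, ← h1, ← h2]
    have f1 : (1 / 4 : ℂ) - (n + 1) = -(4 * n + 3) / 4 := by ring
    have f2 : (1 / 4 : ℂ) + (n + 1) = (4 * n + 5) / 4 := by ring
    have f3 : (1 / 4 + t : ℂ) - (n + 1) = -(4 * n + 3) / 4 + t := by ring
    have f4 : (1 / 4 + t : ℂ) + (n + 1) = (4 * n + 5) / 4 + t := by ring
    have f5 : (1 / 4 - t : ℂ) - (n + 1) = -(4 * n + 3) / 4 - t := by ring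
    have f6 : (1 / 4 - t : ℂ) + (n + 1) = (4 * n + 5) / 4 - t := by ring
    simp only [cotTerm, f1, f2, f3, f4, f5, f6]
    push_cast
    rw [one_div_div, one_div_div]
    ring
  · have h1 := one_div_add_one_div_sub_eq a one_ne_zero
    rw [← ht] at h1
    push_cast at h1 hcot ⊢
    linear_combination h1 - hcot

lemma tsum_sechTerm {a : ℝ} (ha : 0 < a) :
    ∑' m, sechTerm a m = Real.pi / (4 * a ^ 2) * (1 - 1 / Real.cosh (Real.pi * a / 2)) := by
  have hsum := summable_sechTerm a
  have hsum1 : Summable fun n => sechTerm a (n + 1) := (summable_nat_add_iff 1).2 hsum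
  have heven : Summable fun n => sechTerm a (2 * n + 1) :=
    hsum1.comp_injective (i := fun n => 2 * n) (fun x y h => by simp only at h; omega)
  have hodd : Summable fun n => sechTerm a (2 * n + 1 + 1) :=
    hsum1.comp_injective (i := fun n => 2 * n + 1) (fun x y h => by simp only at h; omega)
  have h := (hasSum_sechTerm_pairs ha.ne').unique
    ((heven.hasSum.add hodd.hasSum).mul_left (-8 * a ^ 2))
  rw [hsum.tsum_eq_zero_add, 
    ← tsum_even_add_odd (f := fun n => sechTerm a (n + 1)) heven hodd]
  have ha2 : a ^ 2 ≠ 0 := by positivity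
  have h1a : 1 + a ^ 2 ≠ 0 := by positivity
  have hch := (Real.cosh_pos (Real.pi * a / 2)).ne'
  have h0' : sechTerm a 0 = 1 / (1 + a ^ 2) := by simp [sechTerm]
  rw [h0']
  refine mul_left_cancel₀ (mul_ne_zero (by norm_num : (-8 : ℝ) ≠ 0) ha2) ?_
  rw [mul_add, ← h]
  field_simp
  ring

end

/-! ### Circle averages: Parseval and mean values -/

section

open Complex Metric Set
open scoped ComplexConjugate

lemma hasSum_circleAverage {ι E : Type*} [Countable ι] [NormedAddCommGroup E] [NormedSpace ℝ E]
    {f : ι → ℂ → E} {g : ℂ → E} {u : ι → ℝ}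
    (hf : ∀ i, ContinuousOn (f i) (sphere 0 1)) (hu : Summable u)
    (hfu : ∀ i, ∀ z ∈ sphere (0 : ℂ) 1, ‖f i z‖ ≤ u i)
    (hg : ∀ z ∈ sphere (0 : ℂ) 1, HasSum (fun i => f i z) (g z)) :
    HasSum (fun i => Real.circleAverage (f i) 0 1) (Real.circleAverage g 0 1) := by
  have hmem : ∀ t, circleMap 0 1 t ∈ sphere (0 : ℂ) 1 := circleMap_mem_sphere 0 zero_le_one
  refine HasSum.const_smul _ (intervalIntegral.hasSum_integral_of_dominated_convergence
    (fun i _ => u i) (fun i => ?_) (fun i => ?_) ?_ ?_ ?_)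
  · exact ((hf i).comp_continuous (continuous_circleMap 0 1) hmem).aestronglyMeasurable
  · exact Filter.Eventually.of_forall fun t _ => hfu i _ (hmem t)
  · exact Filter.Eventually.of_forall fun t _ => hu
  · exact intervalIntegrable_const
  · exact Filter.Eventually.of_forall fun t _ => hg _ (hmem t)

lemma circleAverage_pow {n : ℕ} (hn : n ≠ 0) :
    Real.circleAverage (fun z : ℂ => z ^ n) 0 1 = 0 := by
  have : DiffContOnCl ℂ (fun z : ℂ => z ^ n) (ball 0 |1|) :=
    (differentiable_id.pow n).diffContOnCl
  rw [this.circleAverage, zero_pow hn]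

lemma circleAverage_pow_mul_inv_pow (n m : ℕ) :
    Real.circleAverage (fun z : ℂ => z ^ n * z⁻¹ ^ m) 0 1 = if n = m then 1 else 0 := by
  have hne : ∀ z ∈ sphere (0 : ℂ) |1|, z ≠ 0 := fun z hz => by
    rintro rfl
    simp at hz
  rcases lt_trichotomy n m with h | rfl | h
  · obtain ⟨k, rfl⟩ := Nat.exists_eq_add_of_lt h
    rw [if_neg h.ne]
    refine Eq.trans ?_ (circleAverage_pow k.succ_ne_zero)
    -- Averages are invariant under $z\mapsto z^{-1}$, which makes the exponent positive.
    rw [← Real.circleAverage_zero_one_congr_inv]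
    refine Real.circleAverage_congr_sphere fun z hz => ?_
    simp only [inv_inv, Nat.succ_eq_add_one]
    rw [add_assoc, pow_add, ← mul_assoc, ← mul_pow, inv_mul_cancel₀ (hne z hz), one_pow, one_mul]
  · rw [if_pos rfl]
    refine Real.circleAverage_const_on_circle fun z hz => ?_
    rw [← mul_pow, mul_inv_cancel₀ (hne z hz), one_pow]
  · obtain ⟨k, rfl⟩ := Nat.exists_eq_add_of_lt h
    rw [if_neg h.ne']
    refine Eq.trans ?_ (circleAverage_pow k.succ_ne_zero)
    refine Real.circleAverage_congr_sphere fun z hz => ?_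
    simp only [Nat.succ_eq_add_one]
    rw [add_assoc, pow_add, mul_right_comm, ← mul_pow, mul_inv_cancel₀ (hne z hz), one_pow, one_mul]

lemma conj_squareMap {z : ℂ} (hz : ‖z‖ = 1) : conj (squareMap z) = squareMap z⁻¹ := by
  rw [squareMap, conj_tsum, squareMap, inv_eq_conj hz]
  simp

/-- Parseval: on the circle $\overline{f(z)}=f(z^{-1})$, the product of the two series converges
absolutely and uniformly, and only diagonal terms survive averaging. -/
lemma circleAverage_norm_squareMap_sq :
    Real.circleAverage (fun z => ‖squareMap z‖ ^ 2) 0 1 = ∑' k, squareMapCoeff k ^ 2 := by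
  have hpos := fun k => (squareMapCoeff_pos k).le
  have hu : Summable fun p : ℕ × ℕ => squareMapCoeff p.1 * squareMapCoeff p.2 :=
    summable_squareMapCoeff.mul_of_nonneg summable_squareMapCoeff hpos hpos
  have hbound : ∀ (p : ℕ × ℕ) (z : ℂ), ‖z‖ = 1 →
      ‖((squareMapCoeff p.1 : ℂ) * z ^ (4 * p.1 + 1)) *
        ((squareMapCoeff p.2 : ℂ) * z⁻¹ ^ (4 * p.2 + 1))‖ ≤
      squareMapCoeff p.1 * squareMapCoeff p.2 := fun p z hz => by
    rw [norm_mul]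
    exact mul_le_mul (norm_squareMap_term_le hz.le _)
      (norm_squareMap_term_le (by rw [norm_inv, hz, inv_one]) _) (norm_nonneg _) (hpos _)
  have h := hasSum_circleAverage (E := ℂ) (g := fun z => ((‖squareMap z‖ ^ 2 : ℝ) : ℂ))
    (f := fun (p : ℕ × ℕ) z => ((squareMapCoeff p.1 : ℂ) * z ^ (4 * p.1 + 1)) *
        ((squareMapCoeff p.2 : ℂ) * z⁻¹ ^ (4 * p.2 + 1)))
    (fun p => ?_) hu (fun p z hz => hbound p z (by simpa using hz)) ?_
  · have e : ∀ p : ℕ × ℕ, Real.circleAverage (fun z : ℂ => ((squareMapCoeff p.1 : ℂ) *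
        z ^ (4 * p.1 + 1)) * ((squareMapCoeff p.2 : ℂ) * z⁻¹ ^ (4 * p.2 + 1))) 0 1 =
        ((if p.1 = p.2 then squareMapCoeff p.1 ^ 2 else 0 : ℝ) : ℂ) := fun p => by
      have : (fun z : ℂ => ((squareMapCoeff p.1 : ℂ) * z ^ (4 * p.1 + 1)) *
          ((squareMapCoeff p.2 : ℂ) * z⁻¹ ^ (4 * p.2 + 1))) = fun z =>
          ((squareMapCoeff p.1 : ℂ) * squareMapCoeff p.2) •
            (z ^ (4 * p.1 + 1) * z⁻¹ ^ (4 * p.2 + 1)) := by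
        ext z
        rw [smul_eq_mul]
        ring
      rw [this, Real.circleAverage_fun_smul, circleAverage_pow_mul_inv_pow]
      by_cases hp : p.1 = p.2
      · simp [hp, sq]
      · simp [hp]
    simp only [e] at h
    have hinj : Function.Injective fun k : ℕ => (k, k) := fun a b h => congrArg Prod.fst h
    rw [← hinj.hasSum_iff] at h
    · have h' : HasSum (fun k => ((squareMapCoeff k ^ 2 : ℝ) : ℂ))
          (Real.circleAverage (fun z => ((‖squareMap z‖ ^ 2 : ℝ) : ℂ)) 0 1) := by
        simpa [Function.comp_def] using h
      have e2 : Real.circleAverage (fun z => ((‖squareMap z‖ ^ 2 : ℝ) : ℂ)) 0 1 =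
          ((Real.circleAverage (fun z => ‖squareMap z‖ ^ 2) 0 1 : ℝ) : ℂ) := by
        rw [Real.circleAverage, Real.circleAverage, intervalIntegral.integral_ofReal, smul_eq_mul,
          real_smul, ofReal_mul]
      rw [e2, hasSum_ofReal] at h'
      exact h'.tsum_eq.symm
    · rintro ⟨i, j⟩ hij
      have : i ≠ j := by
        rintro rfl
        exact hij ⟨i, rfl⟩
      simp [this]
  · have : ContinuousOn (fun z : ℂ => z⁻¹) (sphere 0 1) := continuousOn_inv₀.mono fun z hz => by
      rintro rfl
      simp at hz
    fun_prop
  · intro z hz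
    have hz1 : ‖z‖ = 1 := by simpa using hz
    have := (hasSum_squareMap hz1.le).mul
      (hasSum_squareMap (z := z⁻¹) (by rw [norm_inv, hz1, inv_one]))
      (Summable.of_norm_bounded hu fun p => hbound p z hz1)
    rwa [← conj_squareMap hz1, mul_conj, normSq_eq_norm_sq] at this

lemma diffContOnCl_alignedSquareMap : DiffContOnCl ℂ alignedSquareMap (ball 0 1) :=
  diffContOnCl_squareMap.const_smul (exp (-(Real.pi / 4 : ℝ) * I))

lemma norm_alignedSquareMap (z : ℂ) : ‖alignedSquareMap z‖ = ‖squareMap z‖ := by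
  rw [alignedSquareMap, norm_mul, ← ofReal_neg, norm_exp_ofReal_mul_I, one_mul]

lemma circleAverage_re_of_diffContOnCl {g : ℂ → ℂ} (hg : DiffContOnCl ℂ g (ball 0 1)) :
    Real.circleAverage (fun z => (g z).re) 0 1 = (g 0).re := by
  have hint : CircleIntegrable g 0 1 := by
    refine ContinuousOn.circleIntegrable zero_le_one (hg.continuousOn_ball.mono ?_)
    exact sphere_subset_closedBall
  rw [← abs_one (α := ℝ)] at hg
  rw [← hg.circleAverage]
  exact reCLM.circleAverage_comp_comm hint

lemma circleIntegrable_re_of_diffContOnCl {g : ℂ → ℂ} (hg : DiffContOnCl ℂ g (ball 0 1)) :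
    CircleIntegrable (fun z => (g z).re) 0 1 :=
  ContinuousOn.circleIntegrable zero_le_one
    (continuous_re.comp_continuousOn (hg.continuousOn_ball.mono sphere_subset_closedBall))

/-- $(\mathrm{Re}\,w)^2=\frac12(|w|^2+\mathrm{Re}\,w^2)$, and $\mathrm{Re}\,g^2$ averages to its
value 0 at the centre. -/
lemma circleAverage_alignedSquareMap_re_sq :
    Real.circleAverage (fun z => (alignedSquareMap z).re ^ 2) 0 1 =
      (∑' k, squareMapCoeff k ^ 2) / 2 := by
  have hd : DiffContOnCl ℂ (fun z => alignedSquareMap z * alignedSquareMap z) (ball 0 1) :=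
    diffContOnCl_alignedSquareMap.smul diffContOnCl_alignedSquareMap
  have h := circleAverage_re_of_diffContOnCl hd
  have hc := diffContOnCl_alignedSquareMap.continuousOn_ball.mono
    (sphere_subset_closedBall (x := (0 : ℂ)))
  have hi : CircleIntegrable (fun z => ‖squareMap z‖ ^ 2) 0 1 := by
    refine ContinuousOn.circleIntegrable zero_le_one ?_
    simpa only [norm_alignedSquareMap] using! hc.norm.pow 2
  have e : (fun z => (alignedSquareMap z).re ^ 2) = fun z => (1 / 2 : ℝ) •
      (‖squareMap z‖ ^ 2 + (alignedSquareMap z * alignedSquareMap z).re) := by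
    ext z
    rw [← norm_alignedSquareMap, ← normSq_eq_norm_sq, normSq_apply, mul_re, smul_eq_mul]
    ring
  rw [e, Real.circleAverage_fun_smul, Real.circleAverage_fun_add hi
    (circleIntegrable_re_of_diffContOnCl hd), h, circleAverage_norm_squareMap_sq,
    alignedSquareMap_zero, smul_eq_mul]
  simp
  ring

/-! ### Harmonic extension of the cosine series into the square -/

lemma cos_re (w : ℂ) : (cos w).re = Real.cos w.re * Real.cosh w.im := by
  rw [cos_eq, ← ofReal_cos, ← ofReal_cosh, ← ofReal_sin, ← ofReal_sinh]
  simp [-ofReal_cos, -ofReal_cosh, -ofReal_sin, -ofReal_sinh]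

/-- On the vertical sides both cosines vanish; on the horizontal ones the factor $\cosh$ of the
imaginary part is exactly the denominator. -/
lemma re_cos_div_cosh_of_mem_squareBoundary {a : ℝ} (ha : 0 < a) {w : ℂ}
    (hw : w ∈ squareBoundary a) (n : ℕ) :
    (cos (((2 * n + 1) * Real.pi / (2 * a) : ℝ) * w)).re / Real.cosh ((2 * n + 1) * Real.pi / 2) =
      Real.cos ((2 * n + 1) * (Real.pi * w.re / (2 * a))) := by
  have e : (2 * n + 1) * Real.pi / (2 * a) * w.re = (2 * n + 1) * (Real.pi * w.re / (2 * a)) := by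
    ring
  rw [cos_re, re_ofReal_mul, im_ofReal_mul, e]
  rcases hw with ⟨h, -⟩ | ⟨h, -⟩
  · have : Real.cos ((2 * n + 1) * (Real.pi * w.re / (2 * a))) = 0 := by
      rw [← Real.cos_abs, abs_mul, abs_div, abs_mul, h, abs_of_pos Real.pi_pos,
        abs_of_pos (by positivity : (0 : ℝ) < 2 * a), abs_of_pos (by positivity), Real.cos_eq_zero_iff]
      refine ⟨n, ?_⟩
      push_cast
      field_simp
    rw [this, zero_mul, zero_div]
  · rw [← Real.cosh_abs ((2 * n + 1) * Real.pi / (2 * a) * w.im), abs_mul, h,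
      abs_of_pos (div_pos (mul_pos (by positivity) Real.pi_pos) (by positivity)),
      show (2 * n + 1) * Real.pi / (2 * a) * a = (2 * n + 1) * Real.pi / 2 by field_simp,
      mul_div_cancel_right₀ _ (Real.cosh_pos _).ne']

lemma abs_re_le_of_mem_squareBoundary {a : ℝ} {w : ℂ} (hw : w ∈ squareBoundary a) : |w.re| ≤ a := by
  rcases hw with h | h
  exacts [h.1.le, h.2]

lemma summable_one_div_two_mul_add_one_cube :
    Summable fun n : ℕ => 1 / (2 * n + 1 : ℝ) ^ 3 := by
  have := (Real.summable_one_div_nat_pow (p := 3)).2 (by norm_num)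
  exact_mod_cast this.comp_injective (i := fun n => 2 * n + 1)
    (fun x y h => by simp only at h; omega)

lemma hasSum_neg_one_pow_div_cube_div_cosh :
    HasSum (fun n : ℕ => (-1) ^ n / (2 * n + 1 : ℝ) ^ 3 / Real.cosh ((2 * n + 1) * Real.pi / 2))
      (Real.pi ^ 3 / 32 * (1 - (∑' k, squareMapCoeff k ^ 2) / halfDiagonal ^ 2)) := by
  have ha := halfSide_pos
  have hL := halfDiagonal_pos
  have hd : ∀ n : ℕ, DiffContOnCl ℂ (fun z =>
      cos (((2 * n + 1) * Real.pi / (2 * halfSide) : ℝ) * alignedSquareMap z)) (ball 0 1) :=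
    fun n => differentiable_cos.comp_diffContOnCl (diffContOnCl_alignedSquareMap.const_smul
      (((2 * n + 1) * Real.pi / (2 * halfSide) : ℝ) : ℂ))
  have hmem : ∀ z ∈ sphere (0 : ℂ) 1, alignedSquareMap z ∈ squareBoundary halfSide :=
    fun z hz => alignedSquareMap_mem_squareBoundary (by simpa using hz)
  have key := hasSum_circleAverage (E := ℝ)
    (f := fun (n : ℕ) z => ((-1) ^ n / (2 * n + 1 : ℝ) ^ 3 / Real.cosh ((2 * n + 1) * Real.pi / 2)) •
      (cos (((2 * n + 1) * Real.pi / (2 * halfSide) : ℝ) * alignedSquareMap z)).re)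
    (g := fun z => Real.pi / 8 * (Real.pi ^ 2 / 4 -
      (Real.pi * (alignedSquareMap z).re / (2 * halfSide)) ^ 2))
    (fun n => ?_) summable_one_div_two_mul_add_one_cube ?_ ?_
  · have e : ∀ z, Real.pi / 8 * (Real.pi ^ 2 / 4 -
        (Real.pi * (alignedSquareMap z).re / (2 * halfSide)) ^ 2) =
        Real.pi ^ 3 / 32 - (Real.pi ^ 3 / (32 * halfSide ^ 2)) • (alignedSquareMap z).re ^ 2 := by
      intro z
      rw [smul_eq_mul]
      field_simp
      ring
    simp only [e] at key
    have hc := diffContOnCl_alignedSquareMap.continuousOn_ball.mono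
      (sphere_subset_closedBall (x := (0 : ℂ)))
    have hre : ContinuousOn (fun z => (alignedSquareMap z).re) (sphere 0 1) :=
      continuous_re.comp_continuousOn hc
    have hi : CircleIntegrable (fun z => (Real.pi ^ 3 / (32 * halfSide ^ 2)) •
        (alignedSquareMap z).re ^ 2) 0 1 :=
      ContinuousOn.circleIntegrable zero_le_one (by fun_prop)
    rw [Real.circleAverage_fun_sub (circleIntegrable_const _ _ _) hi, Real.circleAverage_const, Real.circleAverage_fun_smul,
      circleAverage_alignedSquareMap_re_sq, halfSide_sq] at key
    convert! key using 1
    · ext n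
      rw [Real.circleAverage_fun_smul, circleAverage_re_of_diffContOnCl (hd n),
        alignedSquareMap_zero]
      simp
    · rw [smul_eq_mul]
      field_simp
  · have hre : ContinuousOn (fun z =>
        (cos (((2 * n + 1) * Real.pi / (2 * halfSide) : ℝ) * alignedSquareMap z)).re)
        (sphere 0 1) :=
      continuous_re.comp_continuousOn ((hd n).continuousOn_ball.mono sphere_subset_closedBall)
    fun_prop
  · intro n z hz
    rw [smul_eq_mul, div_mul_eq_mul_div, mul_div_assoc,
      re_cos_div_cosh_of_mem_squareBoundary ha (hmem z hz), norm_mul, norm_div, norm_pow, norm_neg,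
      norm_one, one_pow, Real.norm_of_nonneg (by positivity : (0 : ℝ) ≤ (2 * n + 1) ^ 3)]
    exact mul_le_of_le_one_right (by positivity) (Real.abs_cos_le_one _)
  · intro z hz
    have hx := abs_re_le_of_mem_squareBoundary (hmem z hz)
    have := hasSum_neg_one_pow_div_cube_mul_cos
      (x := Real.pi * (alignedSquareMap z).re / (2 * halfSide)) (by
        rw [abs_div, abs_mul, abs_of_pos Real.pi_pos,
          abs_of_pos (by positivity : 0 < 2 * halfSide), div_le_div_iff₀ (by positivity) two_pos]
        nlinarith [Real.pi_pos])
    convert! this using 2 with n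
    rw [smul_eq_mul, div_mul_eq_mul_div, mul_div_assoc,
      re_cos_div_cosh_of_mem_squareBoundary ha (hmem z hz)]

end

/-! ### The double series and the conclusion -/

lemma squareTerm_succPNat (n m : ℕ) :
    squareTerm n.succPNat m.succPNat = (-1) ^ n / (2 * n + 1) * sechTerm (2 * n + 1) m := by
  rw [squareTerm, sechTerm, div_mul_div_comm]
  simp only [Nat.succPNat_coe, Nat.succ_eq_add_one]
  push_cast
  congr 1
  · ring
  · ring

lemma summable_one_div_succ_sq : Summable fun n : ℕ => 1 / ((n : ℝ) + 1) ^ 2 := by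
  exact_mod_cast (summable_nat_add_iff 1).2 (Real.summable_one_div_nat_pow.2 one_lt_two)

lemma abs_squareTerm_succPNat_le (n m : ℕ) :
    |squareTerm n.succPNat m.succPNat| ≤ 1 / ((n : ℝ) + 1) ^ 2 * (1 / ((m : ℝ) + 1) ^ 2) := by
  have hn : (0 : ℝ) ≤ n := n.cast_nonneg
  have hm : (0 : ℝ) ≤ m := m.cast_nonneg
  rw [squareTerm_succPNat, sechTerm, div_mul_div_comm, abs_div, ← pow_add, abs_pow, abs_neg,
    abs_one, one_pow, abs_of_pos (by positivity), div_mul_div_comm, one_mul]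
  apply one_div_le_one_div_of_le (by positivity)
  calc ((n : ℝ) + 1) ^ 2 * (m + 1) ^ 2 = ((n + 1) * (m + 1)) * ((n + 1) * (m + 1)) := by ring
    _ ≤ ((2 * n + 1) * (2 * m + 1)) * ((2 * m + 1) ^ 2 + (2 * n + 1) ^ 2) := by
      gcongr
      · linarith
      · linarith
      -- A sum of two squares dominates the product, so the bound separates into a product of
      -- summable sequences.
      · nlinarith [mul_nonneg hn hm, sq_nonneg ((m : ℝ) - n)]
    _ = _ := by ring

lemma summable_squareTerm : Summable fun p : ℕ+ × ℕ+ => squareTerm p.1 p.2 := by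
  rw [← (Equiv.pnatEquivNat.symm.prodCongr Equiv.pnatEquivNat.symm).summable_iff]
  exact Summable.of_norm_bounded (summable_one_div_succ_sq.mul_of_nonneg summable_one_div_succ_sq
    (fun n => by positivity) (fun n => by positivity))
    fun p => abs_squareTerm_succPNat_le p.1 p.2

lemma tsum_squareTerm :
    ∑' n : ℕ+, ∑' m : ℕ+, squareTerm n m = Real.pi / 4 * ∑' n : ℕ,
      ((-1) ^ n / (2 * n + 1 : ℝ) ^ 3 -
        (-1) ^ n / (2 * n + 1 : ℝ) ^ 3 / Real.cosh ((2 * n + 1) * Real.pi / 2)) := by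
  rw [← Equiv.pnatEquivNat.symm.tsum_eq, ← tsum_mul_left]
  congr 1
  ext n
  rw [← Equiv.pnatEquivNat.symm.tsum_eq]
  simp only [Equiv.pnatEquivNat_symm_apply, squareTerm_succPNat]
  rw [tsum_mul_left, tsum_sechTerm (by positivity), mul_comm Real.pi (2 * (n : ℝ) + 1)]
  have : (2 * (n : ℝ) + 1) ≠ 0 := by positivity
  have := (Real.cosh_pos ((2 * n + 1) * Real.pi / 2)).ne'
  field_simp

lemma hasSum_neg_one_pow_div_cube :
    HasSum (fun n : ℕ => (-1) ^ n / (2 * n + 1 : ℝ) ^ 3) (Real.pi ^ 3 / 32) := by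
  have h := hasSum_neg_one_pow_div_cube_mul_cos (x := 0)
    (by rw [abs_zero]; linarith [Real.pi_pos])
  simp only [mul_zero, Real.cos_zero, mul_one] at h
  convert! h using 1
  ring

theorem mainTheorem5 :
    Summable (fun k : ℕ =>
        hypergeometricTerm [1 / 4, 1 / 4, 1 / 2, 1 / 2] [5 / 4, 5 / 4, 1] 1 k) ∧
      Summable (fun p : ℕ+ × ℕ+ => squareTerm p.1 p.2) ∧
      generalizedHypergeometric [1 / 4, 1 / 4, 1 / 2, 1 / 2] [5 / 4, 5 / 4, 1] 1 *
          (1 / ProbabilityTheory.beta (1 / 4) (1 / 2) ^ 2) =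
        8 / Real.pi ^ 4 * ∑' n : ℕ+, ∑' m : ℕ+, squareTerm n m := by
  refine ⟨?_, summable_squareTerm, ?_⟩
  · simpa only [hypergeometricTerm_eq_squareMapCoeff_sq] using summable_squareMapCoeff_sq
  · have hL := halfDiagonal_pos
    have hB : ProbabilityTheory.beta (1 / 4) (1 / 2) = 4 * halfDiagonal := by
      rw [halfDiagonal_eq_beta]
      ring
    -- The terms $\pi^3/32$ cancel, leaving $\frac{\pi}{4}\cdot\frac{\pi^3}{32}\cdot S/L^2$ for the
    -- double sum; times $8/\pi^4$ this is $S/(4L)^2$.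
    rw [tsum_squareTerm, (hasSum_neg_one_pow_div_cube.sub
      hasSum_neg_one_pow_div_cube_div_cosh).tsum_eq, generalizedHypergeometric, hB]
    simp only [hypergeometricTerm_eq_squareMapCoeff_sq]
    have := Real.pi_ne_zero
    field_simp
    ring
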